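/- **Theorem 3.** For $n\ge 0$ let $\mathcal S_n$ be the set of permutations of $[n]=\{1,\dots,n\}$, and let $\mathcal S_n^B$ be the hyperoctahedral group of rank $n$, i.e. the set of permutations $\pi$ of $\{\pm1,\dots,\pm n\}$ such that $\pi(-i)=-\pi(i)$ for all $i$. For $\pi$ in $\mathcal S_n$ or in $\mathcal S_n^B$ put $$\mathrm{des}_A(\pi)=\#\{i : 1\le i\le n-1,\ \pi(i)>\pi(i+1)\},$$ and for $\pi\in\mathcal S_n^B$ put $$\mathrm{des}_B(\pi)=\#\{i : 0\le i\le n-1,\ \pi(i)>\pi(i+1)\},\qquad \pi(0):=0 .$$ The Eulerian polynomials of types $A$ and $B$ are $$A_n(x)=\sum_{\pi\in\mathcal S_n}x^{\mathrm{des}_A(\pi)},\qquad B_n(x)=\sum_{\pi\in\mathcal S_n^B}x^{\mathrm{des}_B(\pi)}.$$ For $n\ge1$ define $$C_n^E(x)=\sum_{\pi\in\mathcal S_n^B,\ \pi(1)>0}x^{\mathrm{des}_A(\pi)},\qquad C_n^O(x)=\sum_{\pi\in\mathcal S_n^B,\ \pi(1)<0}x^{\mathrm{des}_A(\pi)}.$$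 (These are the even and odd parts of the flag descent polynomial $C_n(x)=\sum_{\pi\in\mathcal S_n^B}x^{\mathrm{fdes}(\pi)}$, in the sense that $C_n(x)=C_n^E(x^2)+x\,C_n^O(x^2)$; here $\mathrm{fdes}(\pi)=2\,\mathrm{des}_A(\pi)+1$ if $\pi(1)<0$, and $\mathrm{fdes}(\pi)=2\,\mathrm{des}_A(\pi)$ otherwise.) Consider the exponential generating functions, as formal power series in $z$ with coefficients in $\mathbb Q[x]$, $$A(x,z)=\sum_{n\ge0}A_n(x)\frac{z^n}{n!},\qquad B(x,z)=\sum_{n\ge0}B_n(x)\frac{z^n}{n!},$$ $$C^E(x,z)=1+\sum_{n\ge1}C_n^E(x)\frac{z^n}{n!},\qquad C^O(x,z)=\sum_{n\ge1}C_n^O(x)\frac{z^n}{n!}.$$ Then $A(x,z)$ is invertible in $\mathbb Q[x][[z]]$, and $$\frac{A(x,2z)}{A(x,z)}=C^E(x,z),\qquad \frac{B(x,z)}{A(x,z)}=1+x\,C^O(x,z).$$ -/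

import Mathlib

open scoped Nat

noncomputable section

namespace FlagDescent

/-- The set `±[n] = {±1, …, ±n}`. -/
def pmSet (n : ℕ) : Finset ℤ := (Finset.Icc (-(n : ℤ)) n).erase 0

/-- The map `i ↦ -i` of `±[n]`. -/
def pmNeg {n : ℕ} (i : pmSet n) : pmSet n :=
  ⟨-(i : ℤ), by
    obtain ⟨i, hi⟩ := i
    simp only [pmSet, Finset.mem_erase, Finset.mem_Icc] at hi ⊢
    omega⟩

/-- The symmetric group `S_n`: permutations of `[n] = {1, …, n}`. -/
abbrev SymPerm (n : ℕ) : Type := Equiv.Perm (Finset.Icc (1 : ℤ) n)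

/-- The hyperoctahedral group of rank `n`, as a set: signed permutations,
i.e. permutations `π` of `±[n]` such that `π(-i) = -π(i)` for all `i`. -/
abbrev SignedPerm (n : ℕ) : Type :=
  {π : Equiv.Perm (pmSet n) // ∀ i, π (pmNeg i) = pmNeg (π i)}

/-- The value `π(i)` of a permutation `π` of a finite set `s` of integers. It is `0` for `i ∉ s`;
this is used only at `i = 0`, and provides the convention `π(0) = 0` for signed permutations. -/
def value {s : Finset ℤ} (π : Equiv.Perm s) (i : ℤ) : ℤ :=
  if h : i ∈ s then (π ⟨i, h⟩ : ℤ) else 0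

/-- `des_A(π) = #{i ∈ [1, n-1] : π(i) > π(i+1)}`. -/
def desA (n : ℕ) {s : Finset ℤ} (π : Equiv.Perm s) : ℕ :=
  ((Finset.Icc (1 : ℤ) (n - 1)).filter fun i => value π i > value π (i + 1)).card

/-- `des_B(π) = #{i ∈ [0, n-1] : π(i) > π(i+1)}`, where `π(0) = 0`. -/
def desB {n : ℕ} (π : SignedPerm n) : ℕ :=
  ((Finset.Icc (0 : ℤ) (n - 1)).filter fun i => value π.1 i > value π.1 (i + 1)).card

/-- The flag descent number: `2 des_A(π) + 1` if `π(1) < 0`, and `2 des_A(π)` otherwise. -/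
def fdes {n : ℕ} (π : SignedPerm n) : ℕ :=
  if value π.1 1 < 0 then 2 * desA n π.1 + 1 else 2 * desA n π.1

/-- The type A Eulerian polynomial `A_n(x)`. -/
def eulerA (n : ℕ) : Polynomial ℚ := ∑ π : SymPerm n, Polynomial.X ^ desA n π

/-- The type B Eulerian polynomial `B_n(x)`. -/
def eulerB (n : ℕ) : Polynomial ℚ := ∑ π : SignedPerm n, Polynomial.X ^ desB π

/-- The flag descent polynomial `C_n(x)`. -/
def flagPoly (n : ℕ) : Polynomial ℚ := ∑ π : SignedPerm n, Polynomial.X ^ fdes π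

/-- `C_n^E(x)` for `n ≥ 1`: the sum of `x ^ des_A(π)` over the signed permutations with
`π(1) > 0`. -/
def flagEven (n : ℕ) : Polynomial ℚ :=
  ∑ π : SignedPerm n with 0 < value π.1 1, Polynomial.X ^ desA n π.1

/-- `C_n^O(x)` for `n ≥ 1`: the sum of `x ^ des_A(π)` over the signed permutations with
`π(1) < 0`. -/
def flagOdd (n : ℕ) : Polynomial ℚ :=
  ∑ π : SignedPerm n with value π.1 1 < 0, Polynomial.X ^ desA n π.1

/-- `C_n(x) = C_n^E(x²) + x C_n^O(x²)` for `n ≥ 1`. -/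
theorem flagPoly_eq (n : ℕ) (hn : 1 ≤ n) :
    flagPoly n = (flagEven n).comp (Polynomial.X ^ 2)
      + Polynomial.X * (flagOdd n).comp (Polynomial.X ^ 2) := by
  have hne : ∀ π : SignedPerm n, value π.1 1 ≠ 0 := by
    intro π
    have h1 : (1 : ℤ) ∈ pmSet n := by
      simp only [pmSet, Finset.mem_erase, Finset.mem_Icc]
      omega
    rw [value, dif_pos h1]
    exact (Finset.mem_erase.1 (π.1 ⟨1, h1⟩).2).1
  unfold flagPoly flagEven flagOdd
  rw [Polynomial.sum_comp, Polynomial.sum_comp, Finset.mul_sum, Finset.sum_filter,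
    Finset.sum_filter, ← Finset.sum_add_distrib]
  refine Finset.sum_congr rfl fun π _ => ?_
  rcases lt_or_gt_of_ne (hne π) with h | h
  · rw [fdes, if_pos h, if_pos h, if_neg h.le.not_gt, Polynomial.X_pow_comp, zero_add, pow_succ',
      pow_mul]
  · rw [fdes, if_neg h.le.not_gt, if_neg h.le.not_gt, if_pos h, Polynomial.X_pow_comp, add_zero,
      pow_mul]

/-- The exponential generating function `∑_{n ≥ 0} P_n(x) z^n / n!`, a formal power series in `z`
with coefficients in `ℚ[x]`. -/
def egf (P : ℕ → Polynomial ℚ) : PowerSeries (Polynomial ℚ) :=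
  PowerSeries.mk fun n => ((n ! : ℚ)⁻¹) • P n

/-- `A(x,z)`. -/
def genA : PowerSeries (Polynomial ℚ) := egf eulerA

/-- `B(x,z)`. -/
def genB : PowerSeries (Polynomial ℚ) := egf eulerB

/-- `C^E(x,z) = 1 + ∑_{n ≥ 1} C_n^E(x) z^n / n!`. -/
def genE : PowerSeries (Polynomial ℚ) := 1 + egf fun n => if 1 ≤ n then flagEven n else 0

/-- `C^O(x,z) = ∑_{n ≥ 1} C_n^O(x) z^n / n!`. -/
def genO : PowerSeries (Polynomial ℚ) := egf fun n => if 1 ≤ n then flagOdd n else 0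

end FlagDescent

end

/-! Write a signed permutation as the word `π(1) … π(n)`. Fixing its set of negative letters fixes
an alphabet of `n` integers, whose words have descent polynomial `A_n`; so the sum of `x ^ des` over
all signed words is `2 ^ n A_n`. Both identities arise by cutting a signed word as `u ++ v`, where
`u` is the longest prefix with letters of one sign (`sum_signedWords_eq`).

With `u` negative, `v` is empty or begins positive, and the junction is an ascent. Hence `2^n A_n =
∑ k, (n choose k) A_k E_{n-k}` (`two_pow_mul_wordPoly`), where `E_0 = 1` and `E_m = C_m^E`
otherwise.

With `u` positive and a letter `0` put in front, which turns `des_A` into `des_B`, the descent into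
a nonempty `v` can be charged to `0 :: v`. Hence `B_n = ∑ k, (n choose k) A_k ([k = n] + x O_{n-k})`
(`evenPoly_add_X_mul_oddPoly`), where `O_0 = 0` and `O_m = C_m^O` otherwise.

The letters of `v` do not form an interval, so words on arbitrary finite sets are used, together
with the fact that their polynomials depend only on cardinality. -/

namespace FlagDescent

open Polynomial

/-! ### Descents of words and of concatenations. -/

/-- The number of descents of a word of integers. -/
def des : List ℤ → ℕ
  | [] => 0
  | [_] => 0
  | a :: b :: l => (if b < a then 1 else 0) + des (b :: l)

theorem des_cons_cons (a b : ℤ) (l : List ℤ) :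
    des (a :: b :: l) = (if b < a then 1 else 0) + des (b :: l) := by rw [des]

theorem des_singleton (a : ℤ) : des [a] = 0 := by rw [des]

theorem des_nil : des [] = 0 := by rw [des]

theorem des_map (f : ℤ → ℤ) : ∀ l : List ℤ,
    (∀ a ∈ l, ∀ b ∈ l, a < b ↔ f a < f b) → des (l.map f) = des l
  | [], _ => rfl
  | [a], _ => by simp [des_singleton]
  | a :: b :: l, h => by
    have ih := des_map f (b :: l) fun x hx y hy =>
      h x (List.mem_cons_of_mem _ hx) y (List.mem_cons_of_mem _ hy)
    rw [List.map_cons] at ih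
    rw [List.map_cons, List.map_cons, des_cons_cons, des_cons_cons, ih]
    simp only [h b (by simp) a (by simp)]

/-- The junction is an ascent. An empty `v` is covered, because `headI` of the empty word is `0`. -/
theorem des_append_of_neg {v : List ℤ} (hv : 0 ≤ v.headI) : ∀ u : List ℤ,
    (∀ a ∈ u, a < 0) → des (u ++ v) = des u + des v
  | [], _ => by simp [des_nil]
  | [a], h => by
    rcases v with _ | ⟨b, v⟩
    · simp [des_nil]
    · have := h a (by simp)
      simp only [List.headI_cons] at hv
      rw [List.singleton_append, des_cons_cons, des_singleton, if_neg (by omega)]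
  | a :: b :: u, h => by
    have ih := des_append_of_neg hv (b :: u) fun x hx => h x (List.mem_cons_of_mem _ hx)
    rw [List.cons_append] at ih
    rw [List.cons_append, List.cons_append, des_cons_cons, des_cons_cons, ih, add_assoc]

/-- The junction descends exactly when `0 :: v` descends at its start. The condition `0 ∉ v` leaves
the empty word as the only `v` with `headI` equal to `0`. -/
theorem des_append_of_pos {v : List ℤ} (hv : v.headI ≤ 0) (hv' : 0 ∉ v) : ∀ u : List ℤ,
    (∀ a ∈ u, 0 < a) → u ≠ [] → des (u ++ v) = des u + des (0 :: v)
  | [], _, h => absurd rfl h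
  | [a], h, _ => by
    rcases v with _ | ⟨b, v⟩
    · simp [des_singleton]
    · have := h a (by simp)
      have hb : b ≠ 0 := fun h => hv' (by simp [h])
      simp only [List.headI_cons] at hv
      rw [List.singleton_append, des_cons_cons, des_cons_cons, des_singleton, if_pos (by omega),
        if_pos (by omega), zero_add]
  | a :: b :: u, h, _ => by
    have ih := des_append_of_pos hv hv' (b :: u) (fun x hx => h x (List.mem_cons_of_mem _ hx))
      (by simp)
    rw [List.cons_append] at ih
    rw [List.cons_append, List.cons_append, des_cons_cons, des_cons_cons, ih, add_assoc]

/-- The leading `0` adds no descent before a positive letter, and it makes the formula valid for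
empty `u` as well. -/
theorem des_zero_cons_append {u v : List ℤ} (hu : ∀ a ∈ u, 0 < a) (hv : v.headI ≤ 0)
    (hv' : 0 ∉ v) : des (0 :: (u ++ v)) = des u + des (0 :: v) := by
  rcases u with _ | ⟨a, u⟩
  · simp [des_nil]
  · rw [← des_append_of_pos hv hv' _ hu (by simp), List.cons_append, des_cons_cons,
      if_neg (hu a (by simp)).le.not_gt, zero_add]

theorem des_zero_cons (l : List ℤ) : des (0 :: l) = (if l.headI < 0 then 1 else 0) + des l := by
  rcases l with _ | ⟨a, l⟩
  · simp [des_singleton, des_nil]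
  · rw [des_cons_cons, List.headI_cons]

theorem des_map_range (g : ℕ → ℤ) (n : ℕ) : des ((List.range (n + 1)).map g)
    = ((Finset.range n).filter fun i => g (i + 1) < g i).card := by
  induction n generalizing g with
  | zero => simp [des_singleton]
  | succ n ih =>
    rw [List.range_succ_eq_map, List.map_cons, List.map_map]
    have h := ih (g ∘ Nat.succ)
    rw [Finset.card_filter] at h ⊢
    rw [Finset.sum_range_succ', add_comm (Finset.sum _ _)]
    rw [List.range_succ_eq_map, List.map_cons, List.map_map] at h ⊢
    rw [des_cons_cons, h]
    rfl

/-! ### Words enumerating a finite set of integers. -/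

/-- The words in which every element of `S` occurs exactly once and no other letter occurs. -/
def words (S : Finset ℤ) : Finset (List ℤ) :=
  ⟨S.val.lists, Multiset.lists_nodup_finset S⟩

theorem mem_words {S : Finset ℤ} {l : List ℤ} : l ∈ words S ↔ l.Nodup ∧ l.toFinset = S := by
  rw [words, Finset.mem_mk, Multiset.mem_lists_iff]
  constructor
  · intro h
    have hn : l.Nodup := by
      have := S.nodup
      rw [h] at this
      exact Multiset.coe_nodup.1 this
    refine ⟨hn, ?_⟩
    ext a
    rw [List.mem_toFinset, ← Finset.mem_val, h]
    rfl
  · rintro ⟨hn, rfl⟩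
    rw [List.toFinset_val, hn.dedup]
    rfl

/-- The descent polynomial of the set of words that enumerate `S`. -/
noncomputable def wordPoly (S : Finset ℤ) : ℚ[X] := ∑ l ∈ words S, X ^ des l

theorem map_mem_words {S : Finset ℤ} {f : ℤ → ℤ} (hf : Set.InjOn f S) {l : List ℤ}
    (hl : l ∈ words S) : l.map f ∈ words (S.image f) := by
  obtain ⟨h1, rfl⟩ := mem_words.1 hl
  refine mem_words.2
    ⟨h1.map_on fun x hx y hy h => hf (by simpa using hx) (by simpa using hy) h, ?_⟩
  ext a
  simp

theorem map_map_eq_self {α β : Type*} {f : α → β} {g : β → α} {l : List α}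
    (h : ∀ a ∈ l, g (f a) = a) : (l.map f).map g = l := by
  rw [List.map_map]
  exact (List.map_congr_left h).trans (List.map_id l)

theorem wordPoly_image {S : Finset ℤ} {f : ℤ → ℤ} (hf : StrictMonoOn f S) :
    wordPoly (S.image f) = wordPoly S := by
  symm
  have hinj : Set.InjOn f S := hf.injOn
  have hleft : ∀ a ∈ S, Function.invFunOn f S (f a) = a := fun a ha =>
    hinj.leftInvOn_invFunOn ha
  have hright : ∀ b ∈ S.image f, f (Function.invFunOn f S b) = b := by
    intro b hb
    obtain ⟨a, ha, rfl⟩ := Finset.mem_image.1 hb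
    rw [hleft a ha]
  have himg : (S.image f).image (Function.invFunOn f S) = S := by
    rw [Finset.image_image]
    exact (Finset.image_congr hleft).trans Finset.image_id
  refine Finset.sum_nbij' (fun l => l.map f) (fun l => l.map (Function.invFunOn f S))
    (fun l hl => map_mem_words hinj hl) ?_ ?_ ?_ ?_
  · intro l hl
    have h := map_mem_words (f := Function.invFunOn f S) ?_ hl
    · rwa [himg] at h
    · intro b hb b' hb' h
      rw [← hright b hb, h, hright b' hb']
  · intro l hl
    obtain ⟨_, rfl⟩ := mem_words.1 hl
    exact map_map_eq_self fun a ha => hleft a (by simpa using ha)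
  · intro l hl
    obtain ⟨_, h⟩ := mem_words.1 hl
    exact map_map_eq_self fun a ha => hright a (by rw [← h]; simpa using ha)
  · intro l hl
    obtain ⟨_, rfl⟩ := mem_words.1 hl
    rw [des_map]
    intro a ha b hb
    exact (hf.lt_iff_lt (by simpa using ha) (by simpa using hb)).symm

/-- Relabelling along the order isomorphism between two finite sets of equal size preserves
descents. -/
theorem wordPoly_congr {S S' : Finset ℤ} (h : S.card = S'.card) : wordPoly S = wordPoly S' := by
  classical
  let e : S ≃o S' := (S.orderIsoOfFin rfl).symm.trans (S'.orderIsoOfFin h.symm)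
  let f : ℤ → ℤ := fun a => if h : a ∈ S then (e ⟨a, h⟩ : ℤ) else 0
  have hf : ∀ a (h : a ∈ S), f a = e ⟨a, h⟩ := fun a h => dif_pos h
  have hmono : StrictMonoOn f S := by
    intro a ha b hb hab
    rw [hf a ha, hf b hb]
    exact_mod_cast e.strictMono hab
  have himg : S.image f = S' := by
    refine Finset.eq_of_subset_of_card_le (fun b hb => ?_) ?_
    · obtain ⟨a, ha, rfl⟩ := Finset.mem_image.1 hb
      rw [hf a ha]
      exact (e ⟨a, ha⟩).2
    · rw [Finset.card_image_of_injOn hmono.injOn, h]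
  rw [← himg, wordPoly_image hmono]

/-! ### Signed words. -/

/-- The words whose absolute values enumerate a set `T` of positive integers. The set `N` consists
of the absolute values of the negative letters. -/
def signedWords (T : Finset ℤ) : Finset (List ℤ) :=
  T.powerset.biUnion fun N => words ((T \ N) ∪ N.image fun a => -a)

theorem abs_injOn_signs {T N : Finset ℤ} (hT : ∀ a ∈ T, 0 < a) (hN : N ⊆ T) :
    Set.InjOn (fun a : ℤ => |a|) ((T \ N) ∪ N.image fun a => -a : Finset ℤ) := by
  have key : ∀ x ∈ ((T \ N) ∪ N.image fun a => -a : Finset ℤ),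
      (x ∈ T ∧ x ∉ N ∧ 0 < x) ∨ (-x ∈ N ∧ x < 0) := by
    intro x hx
    rw [Finset.mem_union, Finset.mem_sdiff, Finset.mem_image] at hx
    rcases hx with ⟨h1, h2⟩ | ⟨a, ha, rfl⟩
    · exact Or.inl ⟨h1, h2, hT x h1⟩
    · exact Or.inr ⟨by simpa using ha, by have := hT a (hN ha); omega⟩
  intro x hx y hy h
  simp only at h
  rcases key x hx with ⟨_, h2, h3⟩ | ⟨h2, h3⟩ <;> rcases key y hy with ⟨_, h5, h6⟩ | ⟨h5, h6⟩
  · rwa [abs_of_pos h3, abs_of_pos h6] at h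
  · rw [abs_of_pos h3, abs_of_neg h6] at h
    exact absurd (h ▸ h5) h2
  · rw [abs_of_neg h3, abs_of_pos h6] at h
    exact absurd (h ▸ h2) h5
  · rw [abs_of_neg h3, abs_of_neg h6] at h
    exact neg_injective h

theorem image_abs_signs {T N : Finset ℤ} (hT : ∀ a ∈ T, 0 < a) (hN : N ⊆ T) :
    ((T \ N) ∪ N.image fun a => -a : Finset ℤ).image (fun a : ℤ => |a|) = T := by
  ext x
  simp only [Finset.mem_image, Finset.mem_union, Finset.mem_sdiff]
  constructor
  · rintro ⟨a, ⟨h1, _⟩ | ⟨b, hb, rfl⟩, rfl⟩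
    · rwa [abs_of_pos (hT a h1)]
    · rw [abs_neg, abs_of_pos (hT b (hN hb))]
      exact hN hb
  · intro hx
    by_cases h : x ∈ N
    · exact ⟨-x, Or.inr ⟨x, h, rfl⟩, by rw [abs_neg, abs_of_pos (hT x hx)]⟩
    · exact ⟨x, Or.inl ⟨hx, h⟩, abs_of_pos (hT x hx)⟩

theorem mem_signedWords {T : Finset ℤ} (hT : ∀ a ∈ T, 0 < a) {l : List ℤ} :
    l ∈ signedWords T ↔ l.map (fun a => |a|) ∈ words T := by
  rw [signedWords, Finset.mem_biUnion]
  constructor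
  · rintro ⟨N, hN, hl⟩
    rw [Finset.mem_powerset] at hN
    have h := map_mem_words (abs_injOn_signs hT hN) hl
    rwa [image_abs_signs hT hN] at h
  · intro hl
    obtain ⟨h1, h2⟩ := mem_words.1 hl
    have habs : ∀ a ∈ l, |a| ∈ T := fun a ha => by
      rw [← h2, List.mem_toFinset]
      exact List.mem_map_of_mem ha
    have hinj := List.inj_on_of_nodup_map h1
    -- The set of negated letters is read off from the word itself.
    refine ⟨T.filter fun a => -a ∈ l, by simp, mem_words.2 ⟨h1.of_map _, ?_⟩⟩
    ext a
    simp only [List.mem_toFinset, Finset.mem_union, Finset.mem_sdiff, Finset.mem_filter,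
      Finset.mem_image, not_and]
    constructor
    · intro ha
      have hT' := habs a ha
      rcases lt_or_gt_of_ne (abs_pos.1 (hT _ hT')) with h | h
      · rw [abs_of_neg h] at hT'
        exact Or.inr ⟨-a, ⟨hT', by rwa [neg_neg]⟩, neg_neg a⟩
      · rw [abs_of_pos h] at hT'
        refine Or.inl ⟨hT', fun _ hna => ?_⟩
        have := hinj hna ha (abs_neg a)
        omega
    · rintro (⟨h3, h4⟩ | ⟨b, ⟨_, hb⟩, rfl⟩)
      · have h5 := h3
        rw [← h2, List.mem_toFinset, List.mem_map] at h3
        obtain ⟨b, hb, rfl⟩ := h3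
        rcases abs_choice b with h | h
        · rwa [h]
        · exact absurd (by rwa [h, neg_neg]) (h4 h5)
      · exact hb

/-- Each of the `2 ^ T.card` choices of signs gives an alphabet of the same size, hence the same
polynomial. The classes are disjoint since a word determines its signs. -/
theorem sum_signedWords_des {T : Finset ℤ} (hT : ∀ a ∈ T, 0 < a) :
    ∑ l ∈ signedWords T, (X : ℚ[X]) ^ des l = 2 ^ T.card * wordPoly T := by
  rw [signedWords, Finset.sum_biUnion]
  · rw [Finset.sum_congr rfl fun N hN => ?_, Finset.sum_const, Finset.card_powerset,
      nsmul_eq_mul, Nat.cast_pow, Nat.cast_ofNat]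
    rw [Finset.mem_powerset] at hN
    refine wordPoly_congr ?_
    rw [← Finset.card_image_of_injOn (abs_injOn_signs hT hN), image_abs_signs hT hN]
  · intro N hN N' hN' hne
    refine Finset.disjoint_left.2 fun l hl hl' => hne ?_
    have key : ∀ M ∈ T.powerset, l ∈ words ((T \ M) ∪ M.image fun a => -a) →
        ∀ a ∈ T, a ∈ M ↔ -a ∈ l := by
      intro M hM hl a ha
      obtain ⟨_, h2⟩ := mem_words.1 hl
      have hpos := hT a ha
      rw [← List.mem_toFinset, h2, Finset.mem_union, Finset.mem_sdiff]
      constructor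
      · exact fun h => Or.inr (Finset.mem_image_of_mem _ h)
      · rintro (⟨h, _⟩ | h)
        · have := hT _ h
          omega
        · simpa using h
    ext a
    by_cases ha : a ∈ T
    · rw [key N hN hl a ha, key N' hN' hl' a ha]
    · exact iff_of_false (fun h => ha (Finset.mem_powerset.1 hN h))
        fun h => ha (Finset.mem_powerset.1 hN' h)

/-! ### Factorization by the sign of the leading letters; `s` treats both signs at once. -/

theorem mem_words_image_mul {U : Finset ℤ} (hU : ∀ a ∈ U, 0 < a) {s : ℤ} (hs : s = 1 ∨ s = -1)
    {u : List ℤ} : u ∈ words (U.image fun a => s * a) ↔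
      u.map (fun a => |a|) ∈ words U ∧ ∀ a ∈ u, 0 < s * a := by
  have hss : s * s = 1 := by rcases hs with rfl | rfl <;> rfl
  have habs : ∀ a, 0 < a → |s * a| = a := fun a ha => by
    rcases hs with rfl | rfl
    · rw [one_mul, abs_of_pos ha]
    · rw [neg_one_mul, abs_neg, abs_of_pos ha]
  have habs' : ∀ a, 0 < s * a → |a| = s * a := fun a ha => by
    rw [← habs _ ha, ← mul_assoc, hss, one_mul]
  constructor
  · intro h
    have hpos : ∀ a ∈ u, 0 < s * a := by
      intro a ha
      rw [← List.mem_toFinset, (mem_words.1 h).2, Finset.mem_image] at ha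
      obtain ⟨b, hb, rfl⟩ := ha
      rw [← mul_assoc, hss, one_mul]
      exact hU b hb
    refine ⟨?_, hpos⟩
    have := map_mem_words (f := fun a => |a|) ?_ h
    · rwa [Finset.image_image, (Finset.image_congr fun a ha => habs a (hU a ha) :
        U.image ((fun a => |a|) ∘ fun a => s * a) = U.image id), Finset.image_id] at this
    · intro x hx y hy hxy
      simp only [Finset.coe_image, Set.mem_image, Finset.mem_coe] at hx hy hxy
      obtain ⟨x, hx, rfl⟩ := hx
      obtain ⟨y, hy, rfl⟩ := hy
      rw [habs x (hU x hx), habs y (hU y hy)] at hxy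
      rw [hxy]
  · rintro ⟨h, hpos⟩
    have h' := map_mem_words (f := fun a => s * a) (fun x _ y _ hxy => by
      have := congrArg (fun z => s * z) hxy
      simpa only [← mul_assoc, hss, one_mul] using this) h
    rwa [map_map_eq_self fun a ha => by
      rw [habs' a (hpos a ha), ← mul_assoc, hss, one_mul]] at h'

theorem append_mem_words {T U : Finset ℤ} (hU : U ⊆ T) {u v : List ℤ} (hu : u ∈ words U)
    (hv : v ∈ words (T \ U)) : u ++ v ∈ words T := by
  obtain ⟨h1, rfl⟩ := mem_words.1 hu
  obtain ⟨h3, h4⟩ := mem_words.1 hv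
  refine mem_words.2 ⟨List.nodup_append'.2 ⟨h1, h3, fun a ha hb => ?_⟩, ?_⟩
  · rw [← List.mem_toFinset, h4, Finset.mem_sdiff] at hb
    exact hb.2 (List.mem_toFinset.2 ha)
  · rw [List.toFinset_append, h4, Finset.union_sdiff_of_subset hU]

theorem of_append_mem_words {T : Finset ℤ} {u v : List ℤ} (h : u ++ v ∈ words T) :
    u.toFinset ⊆ T ∧ u ∈ words u.toFinset ∧ v ∈ words (T \ u.toFinset) := by
  obtain ⟨h1, rfl⟩ := mem_words.1 h
  obtain ⟨h2, h3, h4⟩ := List.nodup_append'.1 h1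
  rw [List.toFinset_append]
  refine ⟨Finset.subset_union_left, mem_words.2 ⟨h2, rfl⟩, mem_words.2 ⟨h3, ?_⟩⟩
  rw [Finset.union_sdiff_cancel_left (List.disjoint_toFinset_iff_disjoint.2 h4)]

/-- Every signed word is, in a unique way, a word with letters of sign `s` followed by a signed word
that does not begin with a letter of sign `s`. -/
theorem sum_signedWords_eq {M : Type*} [AddCommMonoid M] {T : Finset ℤ} (hT : ∀ a ∈ T, 0 < a)
    {s : ℤ} (hs : s = 1 ∨ s = -1) (F : List ℤ → M) :
    ∑ l ∈ signedWords T, F l = ∑ U ∈ T.powerset, ∑ u ∈ words (U.image fun a => s * a),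
      ∑ v ∈ signedWords (T \ U) with s * v.headI ≤ 0, F (u ++ v) := by
  simp_rw [← Finset.sum_product']
  rw [Finset.sum_sigma']
  let p : ℤ → Bool := fun a => decide (0 < s * a)
  have hsdiff : ∀ U : Finset ℤ, ∀ a ∈ T \ U, 0 < a := fun U a ha => hT a (Finset.mem_sdiff.1 ha).1
  have hsplit : ∀ U u v, U ⊆ T → u ∈ words (U.image fun a => s * a) → s * v.headI ≤ 0 →
      (u ++ v).takeWhile p = u ∧ (u ++ v).dropWhile p = v := by
    intro U u v hU hu hv
    have hpos : ∀ a ∈ u, p a = true := fun a ha => by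
      simpa [p] using ((mem_words_image_mul (fun a ha => hT a (hU ha)) hs).1 hu).2 a ha
    rw [List.takeWhile_append_of_pos hpos, List.dropWhile_append_of_pos hpos]
    rcases v with _ | ⟨b, v⟩
    · simp
    · have : p b = false := by simpa [p] using hv
      simp [this]
  -- `U` is the set of absolute values of the letters in the maximal prefix of sign `s`.
  refine Finset.sum_nbij'
    (fun l => ⟨((l.takeWhile p).map fun a => |a|).toFinset, (l.takeWhile p, l.dropWhile p)⟩)
    (fun x => x.2.1 ++ x.2.2) ?_ ?_ ?_ ?_ ?_
  · intro l hl
    rw [mem_signedWords hT] at hl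
    rw [← List.takeWhile_append_dropWhile (p := p) (l := l), List.map_append] at hl
    obtain ⟨h1, h2, h3⟩ := of_append_mem_words hl
    rw [Finset.mem_sigma, Finset.mem_product, Finset.mem_filter, Finset.mem_powerset,
      mem_signedWords (hsdiff _), mem_words_image_mul (fun a ha => hT a (h1 ha)) hs]
    refine ⟨h1, ⟨h2, fun a ha => ?_⟩, h3, ?_⟩
    · simpa [p] using List.mem_takeWhile_imp ha
    · rcases h : l.dropWhile p with _ | ⟨b, v⟩
      · simp
      · have := List.head_dropWhile_not (l := l) p (by rw [h]; simp)
        simpa [p, h] using this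
  · rintro ⟨U, u, v⟩ hx
    rw [Finset.mem_sigma, Finset.mem_product, Finset.mem_filter, Finset.mem_powerset,
      mem_signedWords (hsdiff _)] at hx
    obtain ⟨h1, h2, h3, h4⟩ := hx
    rw [mem_signedWords hT, List.map_append]
    exact append_mem_words h1 ((mem_words_image_mul (fun a ha => hT a (h1 ha)) hs).1 h2).1 h3
  · intro l _
    exact List.takeWhile_append_dropWhile
  · rintro ⟨U, u, v⟩ hx
    rw [Finset.mem_sigma, Finset.mem_product, Finset.mem_filter, Finset.mem_powerset] at hx
    obtain ⟨h1, h2, h3, h4⟩ := hx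
    obtain ⟨h5, h6⟩ := hsplit U u v h1 h2 h4
    have h7 := ((mem_words_image_mul (fun a ha => hT a (h1 ha)) hs).1 h2).1
    simp only [h5, h6, (mem_words.1 h7).2]
  · intro l _
    simp only [List.takeWhile_append_dropWhile]

/-! ### Permutations and signed permutations as words. -/

/-- The word `π(1) π(2) … π(n)`. -/
def toWord (n : ℕ) {s : Finset ℤ} (π : Equiv.Perm s) : List ℤ :=
  (List.range n).map fun i : ℕ => value π (i + 1)

theorem value_of_mem {s : Finset ℤ} (π : Equiv.Perm s) {i : ℤ} (h : i ∈ s) :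
    value π i = π ⟨i, h⟩ := dif_pos h

theorem value_mem {s : Finset ℤ} (π : Equiv.Perm s) {i : ℤ} (h : i ∈ s) : value π i ∈ s := by
  rw [value_of_mem π h]
  exact (π ⟨i, h⟩).2

theorem value_injOn {s : Finset ℤ} (π : Equiv.Perm s) : Set.InjOn (value π) s := by
  intro i hi j hj h
  rw [value_of_mem π hi, value_of_mem π hj] at h
  simpa using π.injective (Subtype.ext h)

theorem perm_ext {s : Finset ℤ} {π π' : Equiv.Perm s} (h : ∀ i ∈ s, value π i = value π' i) :
    π = π' := by
  ext ⟨i, hi⟩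
  rw [← value_of_mem π hi, ← value_of_mem π' hi, h i hi]

/-- An injective self-map of a finite set gives the values of a permutation. -/
theorem exists_perm {s : Finset ℤ} {f : ℤ → ℤ} (hf : ∀ i ∈ s, f i ∈ s) (hinj : Set.InjOn f s) :
    ∃ π : Equiv.Perm s, ∀ i ∈ s, value π i = f i := by
  have hi : Function.Injective fun i : s => (⟨f i, hf i i.2⟩ : s) := fun i j h =>
    Subtype.ext (hinj i.2 j.2 (Subtype.mk.inj h))
  refine ⟨Equiv.ofBijective _ (Finite.injective_iff_bijective.1 hi), fun i h => ?_⟩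
  rw [value_of_mem _ h, Equiv.ofBijective_apply]

theorem headI_toWord {n : ℕ} (hn : 1 ≤ n) {s : Finset ℤ} (π : Equiv.Perm s) :
    (toWord n π).headI = value π 1 := by
  obtain ⟨n, rfl⟩ := Nat.exists_eq_add_of_le' hn
  rw [toWord, List.range_succ_eq_map, List.map_cons, List.headI_cons]
  simp

/-- The offset `a` is `1` for `desA` and `0` for `desB`. -/
theorem card_filter_Icc (a n : ℕ) (q : ℤ → Prop) [DecidablePred q] :
    ((Finset.Icc (a : ℤ) (n + a - 1)).filter q).card
      = ((Finset.range n).filter fun i : ℕ => q (i + a)).card := by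
  symm
  refine Finset.card_nbij' (fun i : ℕ => (i : ℤ) + a) (fun i => (i - a).toNat) ?_ ?_ ?_ ?_
  · intro i hi
    simp only [Finset.coe_filter, Finset.mem_range, Set.mem_ofPred_eq, Finset.mem_Icc] at hi ⊢
    exact ⟨by omega, hi.2⟩
  · intro i hi
    simp only [Finset.coe_filter, Finset.mem_range, Set.mem_ofPred_eq, Finset.mem_Icc] at hi ⊢
    refine ⟨by omega, ?_⟩
    rw [Int.toNat_of_nonneg (by omega), sub_add_cancel]
    exact hi.2
  · intro i _
    simp
  · intro i hi
    simp only [Finset.coe_filter, Set.mem_ofPred_eq, Finset.mem_Icc] at hi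
    simp only
    omega

theorem des_toWord (n : ℕ) {s : Finset ℤ} (π : Equiv.Perm s) : des (toWord n π) = desA n π := by
  rcases n with _ | n
  · simp [toWord, des_nil, desA]
  · rw [toWord, des_map_range, desA]
    have h := card_filter_Icc 1 n fun i => value π i > value π (i + 1)
    rw [Nat.cast_one, add_sub_cancel_right] at h
    rw [Nat.cast_succ, add_sub_cancel_right, h]
    simp only [Nat.cast_add, Nat.cast_one, gt_iff_lt]

theorem des_zero_cons_toWord {n : ℕ} (π : SignedPerm n) :
    des (0 :: toWord n π.1) = desB π := by
  have h0 : value π.1 0 = 0 := dif_neg (by simp [pmSet])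
  have : 0 :: toWord n π.1 = (List.range (n + 1)).map fun i : ℕ => value π.1 i := by
    rw [List.range_succ_eq_map, List.map_cons, List.map_map, Nat.cast_zero, h0, toWord]
    congr 1
  rw [this, des_map_range, desB]
  have h := card_filter_Icc 0 n fun i => value π.1 i > value π.1 (i + 1)
  rw [Nat.cast_zero, add_zero] at h
  rw [h]
  simp

theorem toWord_eq_iff {n : ℕ} {s s' : Finset ℤ} (π : Equiv.Perm s) (π' : Equiv.Perm s') :
    toWord n π = toWord n π' ↔ ∀ i ∈ Finset.Icc (1 : ℤ) n, value π i = value π' i := by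
  rw [toWord, toWord, List.map_inj_left]
  constructor
  · intro h i hi
    rw [Finset.mem_Icc] at hi
    have := h (i - 1).toNat (List.mem_range.2 (by omega))
    rwa [Int.toNat_of_nonneg (by omega), sub_add_cancel] at this
  · intro h i hi
    rw [List.mem_range] at hi
    exact h _ (Finset.mem_Icc.2 (by omega))

/-- A word enumerating `[n]` in absolute value, as a function on `[n]`. -/
theorem exists_letters {n : ℕ} {l : List ℤ} {g : ℤ → ℤ}
    -- `g` is the identity for permutations and the absolute value for signed permutations.
    (hl : l.map g ∈ words (Finset.Icc (1 : ℤ) n)) :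
    ∃ f : ℤ → ℤ, (List.range n).map (fun i : ℕ => f (i + 1)) = l ∧
      (∀ i ∈ Finset.Icc (1 : ℤ) n, g (f i) ∈ Finset.Icc (1 : ℤ) n) ∧
      Set.InjOn (fun i => g (f i)) (Finset.Icc (1 : ℤ) n) := by
  obtain ⟨h1, h2⟩ := mem_words.1 hl
  have hlen : l.length = n := by
    have := congrArg Finset.card h2
    rw [List.toFinset_card_of_nodup h1, List.length_map, Int.card_Icc] at this
    omega
  have hf : ∀ i ∈ Finset.Icc (1 : ℤ) n, ∃ h : (i - 1).toNat < l.length,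
      l.getD (i - 1).toNat 0 = l[(i - 1).toNat] := by
    intro i hi
    rw [Finset.mem_Icc] at hi
    have : (i - 1).toNat < l.length := by omega
    exact ⟨this, List.getD_eq_getElem _ _ this⟩
  refine ⟨fun i => l.getD (i - 1).toNat 0, ?_, ?_, ?_⟩
  · refine List.ext_getElem (by simp [hlen]) fun i h3 h4 => ?_
    simp [h4]
  · intro i hi
    obtain ⟨h, h'⟩ := hf i hi
    beta_reduce
    rw [h', ← h2, List.mem_toFinset]
    exact List.mem_map_of_mem (List.getElem_mem h)
  · intro i hi j hj hij
    obtain ⟨h3, h4⟩ := hf i hi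
    obtain ⟨h5, h6⟩ := hf j hj
    simp only [h4, h6] at hij
    have := (List.Nodup.getElem_inj_iff h1 (i := (i - 1).toNat) (j := (j - 1).toNat)
      (hi := by simpa using h3) (hj := by simpa using h5)).1 (by simpa using hij)
    simp only [Finset.coe_Icc, Set.mem_Icc] at hi hj
    omega

theorem mem_words_Icc {n : ℕ} {f : ℤ → ℤ}
    (hf : ∀ i ∈ Finset.Icc (1 : ℤ) n, f i ∈ Finset.Icc (1 : ℤ) n)
    (hinj : Set.InjOn f (Finset.Icc (1 : ℤ) n)) :
    (List.range n).map (fun i : ℕ => f (i + 1)) ∈ words (Finset.Icc (1 : ℤ) n) := by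
  have hI : ∀ i : ℕ, i ∈ List.range n → (i : ℤ) + 1 ∈ Finset.Icc (1 : ℤ) n := fun i hi => by
    rw [List.mem_range] at hi
    rw [Finset.mem_Icc]
    omega
  have hn : ((List.range n).map fun i : ℕ => f (i + 1)).Nodup :=
    List.nodup_range.map_on fun i hi j hj h => by
      have := hinj (hI i hi) (hI j hj) h
      omega
  refine mem_words.2 ⟨hn, Finset.eq_of_subset_of_card_le ?_ ?_⟩
  · intro a ha
    rw [List.mem_toFinset, List.mem_map] at ha
    obtain ⟨i, hi, rfl⟩ := ha
    exact hf _ (hI i hi)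
  · rw [List.toFinset_card_of_nodup hn, List.length_map, List.length_range, Int.card_Icc]
    omega

theorem sum_symPerm {M : Type*} [AddCommMonoid M] (n : ℕ) (F : List ℤ → M) :
    ∑ π : SymPerm n, F (toWord n π) = ∑ l ∈ words (Finset.Icc (1 : ℤ) n), F l := by
  refine Finset.sum_bij (fun π _ => toWord n π) ?_ ?_ ?_ fun _ _ => rfl
  · intro π _
    exact mem_words_Icc (fun i hi => value_mem π hi) (value_injOn π)
  · intro π _ π' _ h
    exact perm_ext ((toWord_eq_iff π π').1 h)
  · intro l hl
    obtain ⟨f, rfl, h1, h2⟩ := exists_letters (g := id) (by rwa [List.map_id])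
    obtain ⟨π, hπ⟩ := exists_perm h1 h2
    refine ⟨π, Finset.mem_univ _, List.map_congr_left fun i hi => hπ _ ?_⟩
    rw [List.mem_range] at hi
    rw [Finset.mem_Icc]
    omega

theorem mem_pmSet {n : ℕ} {i : ℤ} : i ∈ pmSet n ↔ |i| ∈ Finset.Icc (1 : ℤ) n := by
  rw [pmSet, Finset.mem_erase, Finset.mem_Icc, Finset.mem_Icc]
  rcases abs_cases i with ⟨h, _⟩ | ⟨h, _⟩ <;> rw [h] <;> omega

theorem value_neg {n : ℕ} (π : SignedPerm n) (i : ℤ) : value π.1 (-i) = -value π.1 i := by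
  by_cases hi : i ∈ pmSet n
  · have hi' : -i ∈ pmSet n := by rwa [mem_pmSet, abs_neg, ← mem_pmSet]
    rw [value_of_mem _ hi, value_of_mem _ hi']
    exact congrArg Subtype.val (π.2 ⟨i, hi⟩)
  · have hi' : -i ∉ pmSet n := by rwa [mem_pmSet, abs_neg, ← mem_pmSet]
    rw [value, value, dif_neg hi, dif_neg hi', neg_zero]

/-- The odd extension `i ↦ sign(i) f(|i|)` of `f` is injective on `±[n]`: absolute values determine
`|i|`, and cancelling `f |i| ≠ 0` determines the sign. -/
theorem exists_signedPerm {n : ℕ} {f : ℤ → ℤ}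
    (hf : ∀ i ∈ Finset.Icc (1 : ℤ) n, |f i| ∈ Finset.Icc (1 : ℤ) n)
    (hinj : Set.InjOn (fun i => |f i|) (Finset.Icc (1 : ℤ) n)) :
    ∃ π : SignedPerm n, ∀ i ∈ Finset.Icc (1 : ℤ) n, value π.1 i = f i := by
  have hg : ∀ i, i ∈ pmSet n → abs (Int.sign i * f |i|) = abs (f |i|) := by
    intro i hi
    have : i ≠ 0 := by
      rintro rfl
      simp [pmSet] at hi
    rw [abs_mul, Int.abs_sign_of_ne_zero this, one_mul]
  obtain ⟨π, hπ⟩ := exists_perm (s := pmSet n) (f := fun i => Int.sign i * f |i|)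
    (fun i hi => by
      rw [mem_pmSet, hg i hi]
      exact hf _ (mem_pmSet.1 hi))
    (fun i hi j hj hij => by
      have habs : |i| = |j| := by
        refine hinj (mem_pmSet.1 hi) (mem_pmSet.1 hj) ?_
        have := congrArg (fun z => |z|) hij
        simp only [hg i hi, hg j hj] at this
        exact this
      have hne : f |j| ≠ 0 := by
        have := hf _ (mem_pmSet.1 hj)
        rw [Finset.mem_Icc] at this
        exact abs_pos.1 (by omega)
      simp only [habs] at hij
      have hs := mul_right_cancel₀ hne hij
      rw [← Int.sign_mul_abs i, ← Int.sign_mul_abs j, hs, habs])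
  refine ⟨⟨π, fun i => ?_⟩, fun i hi => ?_⟩
  · have h1 := hπ i i.2
    have h2 := hπ (pmNeg i) (pmNeg i).2
    rw [value_of_mem π i.2] at h1
    rw [value_of_mem π (pmNeg i).2] at h2
    refine Subtype.ext ?_
    change ((π (pmNeg i) : pmSet n) : ℤ) = -((π i : pmSet n) : ℤ)
    have h3 : ((pmNeg i : pmSet n) : ℤ) = -(i : ℤ) := rfl
    refine h2.trans ?_
    rw [h3, abs_neg, Int.sign_neg, neg_mul, neg_inj]
    exact h1.symm
  · have hpos : 0 < i := by
      rw [Finset.mem_Icc] at hi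
      omega
    rw [hπ i (mem_pmSet.2 (by rwa [abs_of_pos hpos])), abs_of_pos hpos,
      Int.sign_eq_one_of_pos hpos, one_mul]

theorem Icc_pos {n : ℕ} : ∀ a ∈ Finset.Icc (1 : ℤ) n, 0 < a := fun a ha => by
  rw [Finset.mem_Icc] at ha
  omega

theorem sum_signedPerm {M : Type*} [AddCommMonoid M] (n : ℕ) (F : List ℤ → M) :
    ∑ π : SignedPerm n, F (toWord n π.1) = ∑ l ∈ signedWords (Finset.Icc (1 : ℤ) n), F l := by
  have hsub : ∀ i ∈ Finset.Icc (1 : ℤ) n, i ∈ pmSet n := fun i hi => by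
    rwa [mem_pmSet, abs_of_pos (Icc_pos i hi)]
  refine Finset.sum_bij (fun π _ => toWord n π.1) ?_ ?_ ?_ fun _ _ => rfl
  · intro π _
    rw [mem_signedWords Icc_pos, toWord, List.map_map]
    refine mem_words_Icc (f := fun i => |value π.1 i|)
      (fun i hi => mem_pmSet.1 (value_mem π.1 (hsub i hi))) fun i hi j hj h => ?_
    rcases abs_eq_abs.1 h with h | h
    · exact value_injOn π.1 (hsub i hi) (hsub j hj) h
    · rw [← value_neg] at h
      have := value_injOn π.1 (hsub i hi)
        (by rw [Finset.mem_coe, mem_pmSet, abs_neg, ← mem_pmSet]; exact hsub j hj) h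
      have h1 := Icc_pos i hi
      have h2 := Icc_pos j hj
      omega
  · intro π _ π' _ h
    refine Subtype.ext (perm_ext fun i hi => ?_)
    have h1 := (toWord_eq_iff π.1 π'.1).1 h _ (mem_pmSet.1 hi)
    rcases abs_choice i with h2 | h2 <;> rw [h2] at h1
    · exact h1
    · rwa [value_neg, value_neg, neg_inj] at h1
  · intro l hl
    rw [mem_signedWords Icc_pos] at hl
    obtain ⟨f, rfl, h1, h2⟩ := exists_letters hl
    obtain ⟨π, hπ⟩ := exists_signedPerm h1 h2
    refine ⟨π, Finset.mem_univ _, List.map_congr_left fun i hi => hπ _ ?_⟩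
    rw [List.mem_range] at hi
    rw [Finset.mem_Icc]
    omega

/-! ### Even and odd parts, and the two recurrences. -/

/-- The descent polynomial of the signed words on `T` that do not begin with a negative letter. -/
noncomputable def evenPoly (T : Finset ℤ) : ℚ[X] :=
  ∑ l ∈ signedWords T with 0 ≤ l.headI, X ^ des l

/-- The descent polynomial of the signed words on `T` that begin with a negative letter. -/
noncomputable def oddPoly (T : Finset ℤ) : ℚ[X] :=
  ∑ l ∈ signedWords T with l.headI < 0, X ^ des l

theorem evenPoly_add_oddPoly {T : Finset ℤ} (hT : ∀ a ∈ T, 0 < a) :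
    evenPoly T + oddPoly T = 2 ^ T.card * wordPoly T := by
  rw [← sum_signedWords_des hT, evenPoly, oddPoly,
    ← Finset.sum_filter_add_sum_filter_not (signedWords T) fun l : List ℤ => 0 ≤ l.headI]
  simp only [not_le]

theorem sum_signedWords_des_zero_cons (T : Finset ℤ) :
    ∑ l ∈ signedWords T, (X : ℚ[X]) ^ des (0 :: l) = evenPoly T + X * oddPoly T := by
  rw [evenPoly, oddPoly, Finset.mul_sum, Finset.sum_filter, Finset.sum_filter,
    ← Finset.sum_add_distrib]
  refine Finset.sum_congr rfl fun l _ => ?_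
  rw [des_zero_cons]
  by_cases h : l.headI < 0
  · rw [if_pos h, if_pos h, if_neg h.not_ge, zero_add, pow_add, pow_one]
  · rw [if_neg h, if_neg h, if_pos (not_lt.1 h), zero_add, add_zero]

theorem zero_notMem_of_mem_signedWords {T : Finset ℤ} (hT : ∀ a ∈ T, 0 < a) {l : List ℤ}
    (hl : l ∈ signedWords T) : (0 : ℤ) ∉ l := by
  intro h
  rw [mem_signedWords hT, mem_words] at hl
  have h0 : (0 : ℤ) ∈ T := by
    rw [← hl.2, List.mem_toFinset, List.mem_map]
    exact ⟨0, h, abs_zero⟩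
  exact (hT 0 h0).false

theorem nil_mem_signedWords_iff {T : Finset ℤ} (hT : ∀ a ∈ T, 0 < a) :
    [] ∈ signedWords T ↔ T = ∅ := by
  rw [mem_signedWords hT, mem_words]
  simp [eq_comm]

theorem wordPoly_image_mul {U : Finset ℤ} {s : ℤ} (hs : s = 1 ∨ s = -1) :
    wordPoly (U.image fun a => s * a) = wordPoly U := by
  refine wordPoly_congr (Finset.card_image_of_injective _ ?_)
  rcases hs with rfl | rfl
  · exact mul_right_injective₀ one_ne_zero
  · exact mul_right_injective₀ (by norm_num)

/-- Factorization with `s = -1`: the remainder is empty or begins with a positive letter, so it is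
counted by `evenPoly`, and descents add. -/
theorem two_pow_mul_wordPoly {T : Finset ℤ} (hT : ∀ a ∈ T, 0 < a) :
    2 ^ T.card * wordPoly T = ∑ U ∈ T.powerset, wordPoly U * evenPoly (T \ U) := by
  rw [← sum_signedWords_des hT, sum_signedWords_eq hT (Or.inr rfl)]
  refine Finset.sum_congr rfl fun U hU => ?_
  have hpos : ∀ a ∈ U, 0 < a := fun a ha => hT a (Finset.mem_powerset.1 hU ha)
  rw [← wordPoly_image_mul (Or.inr rfl), wordPoly, evenPoly, Finset.sum_mul_sum]
  refine Finset.sum_congr rfl fun u hu => ?_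
  have hu' := ((mem_words_image_mul hpos (Or.inr rfl)).1 hu).2
  refine Finset.sum_congr (Finset.filter_congr fun v _ => by omega) fun v hv => ?_
  rw [Finset.mem_filter] at hv
  rw [des_append_of_neg (by omega) u fun a ha => by have := hu' a ha; omega, pow_add]

/-- The empty word, present only for `T = ∅`, contributes `1`. Every other word here begins
negatively, and the descent from `0` gives the factor `X`. -/
theorem sum_signedWords_headI_nonpos {T : Finset ℤ} (hT : ∀ a ∈ T, 0 < a) :
    ∑ l ∈ signedWords T with l.headI ≤ 0, (X : ℚ[X]) ^ des (0 :: l)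
      = (if T = ∅ then 1 else 0) + X * oddPoly T := by
  have h0 : ∀ l ∈ signedWords T, l.headI = 0 → l = [] := by
    rintro (_ | ⟨a, l⟩) hl h
    · rfl
    · rw [List.headI_cons] at h
      exact absurd (by simp [h]) (zero_notMem_of_mem_signedWords hT hl)
  have h1 : ∑ l ∈ signedWords T, (if l = [] then (1 : ℚ[X]) else 0) = if T = ∅ then 1 else 0 := by
    rw [Finset.sum_ite_eq']
    simp only [nil_mem_signedWords_iff hT]
  rw [← h1, oddPoly, Finset.mul_sum, Finset.sum_filter, Finset.sum_filter,
    ← Finset.sum_add_distrib]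
  refine Finset.sum_congr rfl fun l hl => ?_
  rcases lt_trichotomy l.headI 0 with h | h | h
  · rw [if_pos h.le, if_pos h, if_neg (by rintro rfl; exact h.false), des_zero_cons, if_pos h,
      pow_add, pow_one, zero_add]
  · rw [h0 l hl h]
    simp [des_singleton]
  · rw [if_neg h.not_ge, if_neg h.not_gt, if_neg (by rintro rfl; exact h.false), zero_add]

/-- Factorization with `s = 1`, applied to descents counted after a leading `0`. -/
theorem evenPoly_add_X_mul_oddPoly {T : Finset ℤ} (hT : ∀ a ∈ T, 0 < a) :
    evenPoly T + X * oddPoly T = ∑ U ∈ T.powerset,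
      wordPoly U * ((if T \ U = ∅ then 1 else 0) + X * oddPoly (T \ U)) := by
  rw [← sum_signedWords_des_zero_cons, sum_signedWords_eq hT (Or.inl rfl)]
  refine Finset.sum_congr rfl fun U hU => ?_
  have hpos : ∀ a ∈ U, 0 < a := fun a ha => hT a (Finset.mem_powerset.1 hU ha)
  have hsdiff : ∀ a ∈ T \ U, 0 < a := fun a ha => hT a (Finset.mem_sdiff.1 ha).1
  rw [← wordPoly_image_mul (Or.inl rfl), wordPoly, ← sum_signedWords_headI_nonpos hsdiff,
    Finset.sum_mul_sum]
  refine Finset.sum_congr rfl fun u hu => ?_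
  have hu' := ((mem_words_image_mul hpos (Or.inl rfl)).1 hu).2
  refine Finset.sum_congr (Finset.filter_congr fun v _ => by omega) fun v hv => ?_
  rw [Finset.mem_filter] at hv
  rw [des_zero_cons_append (fun a ha => by have := hu' a ha; omega) (by omega)
    (zero_notMem_of_mem_signedWords hsdiff hv.1), pow_add]

/-! ### Dependence on the cardinality alone. -/

theorem wordPoly_eq_Icc (S : Finset ℤ) : wordPoly S = wordPoly (Finset.Icc 1 (S.card : ℤ)) :=
  wordPoly_congr (by rw [Int.card_Icc]; omega)

theorem wordPoly_empty : wordPoly ∅ = 1 := by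
  have h : words ∅ = {[]} := by
    ext l
    rw [mem_words, List.toFinset_eq_empty_iff, Finset.mem_singleton]
    exact ⟨fun h => h.2, fun h => ⟨h ▸ List.nodup_nil, h⟩⟩
  rw [wordPoly, h, Finset.sum_singleton, des_nil, pow_zero]

/-- No bijection is needed: `two_pow_mul_wordPoly` determines `evenPoly T` recursively, because its
term `U = ∅` is `evenPoly T` and the others involve smaller sets. -/
theorem evenPoly_congr {T T' : Finset ℤ} (hT : ∀ a ∈ T, 0 < a) (hT' : ∀ a ∈ T', 0 < a)
    (h : T.card = T'.card) : evenPoly T = evenPoly T' := by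
  suffices H : ∀ n, ∀ T : Finset ℤ, (∀ a ∈ T, 0 < a) → T.card = n →
      evenPoly T = evenPoly (Finset.Icc 1 (n : ℤ)) by
    rw [H _ T hT rfl, H _ T' hT' rfl, h]
  intro n
  induction n using Nat.strong_induction_on with
  | _ n ih =>
    -- Apart from `evenPoly T`, both sides depend only on `n`; the `if` removes the term `U = ∅`,
    -- which is written separately.
    have key : ∀ T : Finset ℤ, (∀ a ∈ T, 0 < a) → T.card = n →
        2 ^ n * wordPoly (Finset.Icc 1 (n : ℤ)) = evenPoly T * wordPoly ∅ +
          (∑ k ∈ Finset.range (n + 1), n.choose k • (if k = 0 then 0 else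
            wordPoly (Finset.Icc 1 (k : ℤ)) * evenPoly (Finset.Icc 1 ((n - k : ℕ) : ℤ)))) := by
      intro T hT hn
      subst hn
      rw [← wordPoly_eq_Icc, two_pow_mul_wordPoly hT, ← Finset.sum_powerset_apply_card,
        ← Finset.add_sum_erase _ _ (Finset.empty_mem_powerset T), Finset.sdiff_empty, mul_comm]
      congr 1
      rw [← Finset.add_sum_erase _ _ (Finset.empty_mem_powerset T), Finset.card_empty, if_pos rfl,
        zero_add]
      refine Finset.sum_congr rfl fun U hU => ?_
      rw [Finset.mem_erase, Finset.mem_powerset] at hU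
      have hpos := Finset.card_pos.2 (Finset.nonempty_iff_ne_empty.2 hU.1)
      have hle := Finset.card_le_card hU.2
      rw [if_neg hpos.ne', wordPoly_eq_Icc U, ih _ (by omega) (T \ U)
        (fun a ha => hT a (Finset.mem_sdiff.1 ha).1) (Finset.card_sdiff_of_subset hU.2)]
    intro T hT hn
    have h1 := (key T hT hn).symm.trans (key (Finset.Icc 1 (n : ℤ)) Icc_pos (by simp))
    rwa [wordPoly_empty, mul_one, mul_one, add_left_inj] at h1

/-- The even and odd parts sum to `2 ^ T.card * wordPoly T`, which depends only on the cardinality.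
-/
theorem oddPoly_congr {T T' : Finset ℤ} (hT : ∀ a ∈ T, 0 < a) (hT' : ∀ a ∈ T', 0 < a)
    (h : T.card = T'.card) : oddPoly T = oddPoly T' := by
  have h1 := evenPoly_add_oddPoly hT
  rwa [h, wordPoly_congr h, ← evenPoly_add_oddPoly hT', evenPoly_congr hT hT' h,
    add_right_inj] at h1

/-! ### Identification with the Eulerian and flag descent polynomials. -/

theorem eulerA_eq (n : ℕ) : eulerA n = wordPoly (Finset.Icc 1 (n : ℤ)) := by
  rw [wordPoly, ← sum_symPerm]
  simp only [des_toWord]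
  rfl

theorem eulerB_eq (n : ℕ) : eulerB n
    = evenPoly (Finset.Icc 1 (n : ℤ)) + X * oddPoly (Finset.Icc 1 (n : ℤ)) := by
  rw [← sum_signedWords_des_zero_cons, ← sum_signedPerm]
  simp only [des_zero_cons_toWord]
  rfl

theorem flagOdd_eq {n : ℕ} (hn : 1 ≤ n) : flagOdd n = oddPoly (Finset.Icc 1 (n : ℤ)) := by
  rw [oddPoly, Finset.sum_filter, ← sum_signedPerm, flagOdd, Finset.sum_filter]
  simp only [des_toWord, headI_toWord hn]

theorem flagEven_eq {n : ℕ} (hn : 1 ≤ n) : flagEven n = evenPoly (Finset.Icc 1 (n : ℤ)) := by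
  have hne : ∀ π : SignedPerm n, value π.1 1 ≠ 0 := by
    intro π
    have h := value_mem π.1 (i := 1) (mem_pmSet.2 (by simpa using hn))
    exact (Finset.mem_erase.1 h).1
  rw [evenPoly, Finset.sum_filter, ← sum_signedPerm, flagEven, Finset.sum_filter]
  simp only [des_toWord, headI_toWord hn]
  refine Finset.sum_congr rfl fun π _ => ?_
  simp only [(hne π).symm.le_iff_lt]

theorem signedWords_empty : signedWords ∅ = {[]} := by
  ext l
  rw [mem_signedWords (by simp), mem_words]
  simp +contextual

/-- The empty word counts as even, which supplies the constant term `1` of `genE`. -/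
theorem evenPoly_empty : evenPoly ∅ = 1 := by
  simp [evenPoly, signedWords_empty, Finset.sum_filter, des_nil]

theorem oddPoly_empty : oddPoly ∅ = 0 := by
  simp [oddPoly, signedWords_empty, Finset.sum_filter]

/-! ### Generating functions. -/

theorem genE_eq : genE = egf fun n => evenPoly (Finset.Icc 1 (n : ℤ)) := by
  ext1 n
  rw [genE, map_add, egf, egf, PowerSeries.coeff_mk, PowerSeries.coeff_mk, PowerSeries.coeff_one]
  rcases n with _ | n
  · simp [evenPoly_empty]
  · simp [flagEven_eq]

theorem one_add_X_mul_genO_eq : 1 + PowerSeries.C (X : ℚ[X]) * genO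
    = egf fun n => (if n = 0 then 1 else 0) + X * oddPoly (Finset.Icc 1 (n : ℤ)) := by
  ext1 n
  rw [genO, map_add, PowerSeries.coeff_C_mul, egf, egf, PowerSeries.coeff_mk, PowerSeries.coeff_mk,
    PowerSeries.coeff_one]
  rcases n with _ | n
  · simp [oddPoly_empty]
  · simp [flagOdd_eq]

theorem egf_mul (P Q : ℕ → ℚ[X]) : egf P * egf Q = egf fun n =>
    ∑ k ∈ Finset.range (n + 1), n.choose k • (P k * Q (n - k)) := by
  ext1 n
  rw [PowerSeries.coeff_mul, egf, egf, egf, PowerSeries.coeff_mk,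
    Finset.Nat.sum_antidiagonal_eq_sum_range_succ_mk, Finset.smul_sum]
  refine Finset.sum_congr rfl fun k hk => ?_
  have hk' : k ≤ n := Nat.lt_succ_iff.1 (Finset.mem_range.1 hk)
  rw [PowerSeries.coeff_mk, PowerSeries.coeff_mk, smul_mul_smul_comm, ← Nat.cast_smul_eq_nsmul ℚ,
    smul_smul, Nat.cast_choose ℚ hk']
  congr 1
  have := Nat.factorial_ne_zero n
  field_simp

theorem rescale_egf (P : ℕ → ℚ[X]) (c : ℚ[X]) :
    PowerSeries.rescale c (egf P) = egf fun n => c ^ n * P n := by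
  ext1 n
  rw [PowerSeries.coeff_rescale, egf, egf, PowerSeries.coeff_mk, PowerSeries.coeff_mk,
    mul_smul_comm]

theorem rescale_genA : PowerSeries.rescale (2 : ℚ[X]) genA = genE * genA := by
  rw [mul_comm, genE_eq, genA, egf_mul, rescale_egf]
  congr 1
  funext n
  have h := two_pow_mul_wordPoly (Icc_pos (n := n))
  rw [Int.card_Icc, add_sub_cancel_right, Int.toNat_natCast] at h
  rw [eulerA_eq, h]
  have hn : (Finset.Icc 1 (n : ℤ)).card = n := by simp
  -- Grouping the subsets `U` by size produces the binomial coefficients of `egf_mul`.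
  have h2 := Finset.sum_powerset_apply_card
    (fun k => eulerA k * evenPoly (Finset.Icc 1 ((n - k : ℕ) : ℤ))) (x := Finset.Icc 1 (n : ℤ))
  rw [hn] at h2
  rw [← h2]
  refine Finset.sum_congr rfl fun U hU => ?_
  rw [Finset.mem_powerset] at hU
  rw [wordPoly_eq_Icc U, eulerA_eq, evenPoly_congr
    (fun a ha => Icc_pos a (Finset.mem_sdiff.1 ha).1) Icc_pos]
  rw [Finset.card_sdiff_of_subset hU]
  simp

theorem genB_eq : genB = (1 + PowerSeries.C (X : ℚ[X]) * genO) * genA := by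
  rw [mul_comm, one_add_X_mul_genO_eq, genA, egf_mul, genB]
  congr 1
  funext n
  rw [eulerB_eq, evenPoly_add_X_mul_oddPoly Icc_pos]
  have hn : (Finset.Icc 1 (n : ℤ)).card = n := by simp
  have h2 := Finset.sum_powerset_apply_card
    (fun k => eulerA k * ((if n - k = 0 then 1 else 0)
      + X * oddPoly (Finset.Icc 1 ((n - k : ℕ) : ℤ)))) (x := Finset.Icc 1 (n : ℤ))
  rw [hn] at h2
  rw [← h2]
  refine Finset.sum_congr rfl fun U hU => ?_
  rw [Finset.mem_powerset] at hU
  have hc : (Finset.Icc 1 (n : ℤ) \ U).card = n - U.card := by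
    rw [Finset.card_sdiff_of_subset hU, hn]
  rw [wordPoly_eq_Icc U, eulerA_eq, oddPoly_congr
    (T' := Finset.Icc 1 ((n - U.card : ℕ) : ℤ))
    (fun a ha => Icc_pos a (Finset.mem_sdiff.1 ha).1) Icc_pos (by rw [hc]; simp),
    ← hc]
  simp only [Finset.card_eq_zero]

/-- The constant coefficient is `A_0 = 1`, coming from the empty word. -/
theorem isUnit_genA : IsUnit genA := by
  rw [PowerSeries.isUnit_iff_constantCoeff, ← PowerSeries.coeff_zero_eq_constantCoeff_apply, genA,
    egf, PowerSeries.coeff_mk, eulerA_eq]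
  simp [wordPoly_empty]

end FlagDescent

/-- In `ℚ[x]⟦z⟧` the series `A(x,z)` is invertible, `A(x,2z) / A(x,z) = C^E(x,z)` and
`B(x,z) / A(x,z) = 1 + x C^O(x,z)`. Quotients are products with the inverse of the unit `A(x,z)`. -/
theorem theorem3 :
    IsUnit FlagDescent.genA ∧
    PowerSeries.rescale (2 : Polynomial ℚ) FlagDescent.genA * Ring.inverse FlagDescent.genA
      = FlagDescent.genE ∧
    FlagDescent.genB * Ring.inverse FlagDescent.genA
      = 1 + PowerSeries.C (Polynomial.X : Polynomial ℚ) * FlagDescent.genO := by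
  refine ⟨FlagDescent.isUnit_genA, ?_, ?_⟩
  · rw [FlagDescent.rescale_genA, Ring.mul_inverse_cancel_right _ _ FlagDescent.isUnit_genA]
  · rw [FlagDescent.genB_eq, Ring.mul_inverse_cancel_right _ _ FlagDescent.isUnit_genA]
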